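/- Let $X\subset\mathbb{R}^2$ be a finite point set. The relative neighborhood graph $\mathrm{RNG}(X)$ has as edges the pairs $ab$ of distinct points of $X$ for which no $x\in X$ satisfies both $|ax|<|ab|$ and $|bx|<|ab|$; it is drawn with straight segments. An RNG-polygon $\Pi$ of $X$ is a bounded face of this drawing (a bounded connected component of the complement of the union of the edges); its point set $P$ consists of the points of $X$ on its boundary. A triangulation of $\Pi$ is a geometric simplicial complex with vertex set $P$ whose underlying space is the closed polygon $\overline{\Pi}$ and which contains all $\mathrm{RNG}$ edges on the boundary of $\Pi$. Let $\delta_{\mathrm{MML}}$ be the length of the longest edge of a minmax-length triangulation of $\Pi$, i.e. the minimum, over all triangulations of $\Pi$, of the length of the longest edge. Let $\delta_{\mathrm{DR}}$ be the length of the longest Delaunay edge inside $\Pi$, i.e. the maximum of $|ab|$ over the pairs of distinct points $a,b\in P$ such that the segment $ab$ is contained in $\overline{\Pi}$ and some circle through $a$ and $b$ has no point of $P$ in its interior. Then both the minimum and the maximum exist, and $$\frac{\sqrt3}{2}\,\delta_{\mathrm{DR}}\le\delta_{\mathrm{MML}}\le\delta_{\mathrm{DR}}.$$ -/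

import Mathlib

/-- The Euclidean plane. -/
abbrev Plane : Type := EuclideanSpace ℝ (Fin 2)

/-- The lens of the edge `ab` in the point set `X`: the points of `X` whose distances to both
`a` and `b` are smaller than the length of `ab`. -/
def lens (X : Set Plane) (a b : Plane) : Set Plane :=
  {x | x ∈ X ∧ dist a x < dist a b ∧ dist b x < dist a b}

/-- `ab` is an edge of the relative neighborhood graph of `X`. -/
def IsRNGEdge (X : Set Plane) (a b : Plane) : Prop :=
  a ∈ X ∧ b ∈ X ∧ a ≠ b ∧ lens X a b = ∅

/-- The straight-line drawing of the relative neighborhood graph of `X`. -/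
def rngDrawing (X : Set Plane) : Set Plane :=
  {z | ∃ a b, IsRNGEdge X a b ∧ z ∈ segment ℝ a b}

/-- `F` is (the open region enclosed by) an RNG-polygon of `X`: a bounded face, that is, a bounded
connected component of the complement, of the drawing of the relative neighborhood graph. -/
def IsRNGPolygon (X F : Set Plane) : Prop :=
  (∃ z ∈ (rngDrawing X)ᶜ, F = connectedComponentIn (rngDrawing X)ᶜ z) ∧ Bornology.IsBounded F

/-- The point set of the polygon `F`: the points of `X` on its boundary. -/
def polygonPoints (X F : Set Plane) : Set Plane :=
  X ∩ frontier F

/-- `ab` is a Delaunay edge of the point set `P`: some circle through `a` and `b` encloses no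
point of `P` in its interior. -/
def IsDelaunayEdge (P : Set Plane) (a b : Plane) : Prop :=
  a ∈ P ∧ b ∈ P ∧ a ≠ b ∧
    ∃ (c : Plane) (r : ℝ), dist a c = r ∧ dist b c = r ∧ ∀ x ∈ P, r ≤ dist x c

/-- The lengths of the Delaunay edges, of the point set of the polygon `F`, that lie inside the
(closed) polygon. -/
def delaunayLengthsInside (X F : Set Plane) : Set ℝ :=
  {l | ∃ a b, IsDelaunayEdge (polygonPoints X F) a b ∧ segment ℝ a b ⊆ closure F ∧ l = dist a b}

/-- `ab` is an edge of the simplicial complex `K`. -/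
def IsComplexEdge (K : Geometry.SimplicialComplex ℝ Plane) (a b : Plane) : Prop :=
  a ≠ b ∧ ∃ s ∈ K.faces, (s : Set Plane) = {a, b}

/-- The lengths of the edges of the simplicial complex `K`. -/
def edgeLengths (K : Geometry.SimplicialComplex ℝ Plane) : Set ℝ :=
  {l | ∃ a b, IsComplexEdge K a b ∧ l = dist a b}

/-- `K` triangulates the RNG-polygon `F` of `X`: it is a geometric simplicial complex whose
vertices are the points of the polygon, which covers exactly the closed polygon, and which has the
sides of the polygon (also those that have `F` on both sides) among its edges. -/
structure IsPolygonTriangulation (X F : Set Plane) (K : Geometry.SimplicialComplex ℝ Plane) :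
    Prop where
  vertices_iff : ∀ v : Plane, {v} ∈ K.faces ↔ v ∈ polygonPoints X F
  space_eq : K.space = closure F
  sides : ∀ a b, IsRNGEdge X a b → segment ℝ a b ⊆ frontier F → IsComplexEdge K a b

/-- The lengths of the longest edges of the triangulations of the RNG-polygon `F` of `X`. -/
def longestEdgeLengths (X F : Set Plane) : Set ℝ :=
  {l | ∃ K, IsPolygonTriangulation X F K ∧ IsGreatest (edgeLengths K) l}

/-- `δ` is the length of the longest edge of the minmax-length triangulations of the RNG-polygon
`F` of `X`: the least possible length of the longest edge of a triangulation of the polygon. -/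
def IsMinmaxLength (X F : Set Plane) (δ : ℝ) : Prop :=
  IsLeast (longestEdgeLengths X F) δ

/-- `δ` is the length of the longest Delaunay edge inside the RNG-polygon `F` of `X`. -/
def IsLongestDelaunayLength (X F : Set Plane) (δ : ℝ) : Prop :=
  IsGreatest (delaunayLengthsInside X F) δ

/-! ### Lower hulls of height functions on finite point sets. -/

section LowerCells

variable {E : Type*} [NormedAddCommGroup E] [InnerProductSpace ℝ E]

/-! Upper bound. An RNG edge has an empty diametral disc, so it is a face of a Delaunay
triangulation of the polygon's points however ties are broken. The frontier of `F` is a union of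
such edges, so no Delaunay simplex meeting `F` in its interior crosses it; the Delaunay faces inside
`closure F` therefore triangulate the polygon, and all their edges compete in `δDR`
(`IsRNGPolygon.exists_delaunay_triangulation`). The Delaunay complex comes from the lower hull of
the lifting `‖y‖ ^ 2`, whose cells are subdivided by a generic second height
(`exists_delaunay_complex`).

Lower bound (`IsPolygonTriangulation.exists_long_edge`). Let an empty circle through `a`, `b` have
centre `c` and radius `r ≥ |ab| / 2`. If `c` is in the closed polygon, the simplex covering `c` has
all vertices at distance at least `r` from `c`, hence an edge of length at least `√3 r`. Otherwise
the segment from the midpoint of `ab` to `c` hits a side `pq`; comparing distances to `c` gives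
`|pq| ≥ |ab|`, and sides belong to every triangulation.

Both extrema exist because all lengths are distances within the finite set `X`. -/

theorem affineIndependent_finset_iff {s : Finset E} :
    AffineIndependent ℝ ((↑) : s → E) ↔
      ∀ w : E → ℝ, ∑ p ∈ s, w p = 0 → ∑ p ∈ s, w p • p = 0 → ∀ p ∈ s, w p = 0 := by
  classical
  constructor
  · intro h w h0 h1 p hp
    have := affineIndependent_iff.1 h Finset.univ (fun q => w q)
      (by rw [Finset.univ_eq_attach, Finset.sum_attach s w]; exact h0)
      (by rw [Finset.univ_eq_attach, Finset.sum_attach s (fun q => w q • q)]; exact h1)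
    exact this ⟨p, hp⟩ (Finset.mem_univ _)
  · intro h
    rw [affineIndependent_iff]
    intro t w h0 h1 e he
    let w' : E → ℝ := fun q => if hq : q ∈ s then (if (⟨q, hq⟩ : s) ∈ t then w ⟨q, hq⟩ else 0) else 0
    have key : ∀ q : s, w' q = if q ∈ t then w q else 0 := by
      intro q
      simp [w']
    have := h w' (by
      rw [← Finset.sum_attach s w', ← Finset.univ_eq_attach]
      simp only [key]
      rw [Finset.sum_ite_mem, Finset.univ_inter]; exact h0) (by
      rw [← Finset.sum_attach s (fun q => w' q • q), ← Finset.univ_eq_attach]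
      simp only [key, ite_smul, zero_smul]
      rw [Finset.sum_ite_mem, Finset.univ_inter]; exact h1) e e.2
    rw [key, if_pos he] at this
    exact this

/-- Any prescribed values at affinely independent points are attained by an affine function. -/
theorem AffineIndependent.exists_affine_interpolation {s : Finset E}
    (hs : AffineIndependent ℝ ((↑) : s → E)) (g : E → ℝ) :
    ∃ (v : E) (k : ℝ), ∀ p ∈ s, inner ℝ v p + k = g p := by
  classical
  let Φ : E × ℝ →ₗ[ℝ] (s → ℝ) :=
    { toFun := fun x p => inner ℝ x.1 (p : E) + x.2
      map_add' := fun x y => by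
        funext p; simp only [Prod.fst_add, Prod.snd_add, inner_add_left, Pi.add_apply]; ring
      map_smul' := fun c x => by
        funext p
        simp only [Prod.smul_fst, Prod.smul_snd, real_inner_smul_left, Pi.smul_apply, smul_eq_mul,
          RingHom.id_apply]
        ring }
  by_cases hΦ : LinearMap.range Φ = ⊤
  · obtain ⟨x, hx⟩ := LinearMap.range_eq_top.1 hΦ (fun p => g p)
    exact ⟨x.1, x.2, fun p hp => congrFun hx ⟨p, hp⟩⟩
  · exfalso
    -- A nonzero functional killing all attained value vectors has as coefficients an affine
    -- dependence of `s`.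
    obtain ⟨f, hf0, hf⟩ := Submodule.exists_le_ker_of_lt_top _ (lt_top_iff_ne_top.2 hΦ)
    apply hf0
    have hfe : ∀ u : s → ℝ, f u = ∑ p, f (Pi.single p 1) * u p := by
      intro u
      conv_lhs => rw [← Finset.univ_sum_single u, map_sum]
      refine Finset.sum_congr rfl fun p _ => ?_
      have : (Pi.single p (u p) : s → ℝ) = u p • Pi.single p 1 := by
        rw [← Pi.single_smul]; simp
      rw [this, map_smul, smul_eq_mul, mul_comm]
    have hker : ∀ (v : E) (k : ℝ), ∑ p : s, f (Pi.single p 1) * (inner ℝ v (p : E) + k) = 0 := by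
      intro v k
      have := hf ⟨(v, k), rfl⟩
      rw [LinearMap.mem_ker, hfe] at this
      exact this
    have h0 : ∑ p : s, f (Pi.single p 1) = 0 := by simpa using hker 0 1
    have h1 : ∑ p : s, f (Pi.single p 1) • (p : E) = 0 := by
      have := hker (∑ p : s, f (Pi.single p 1) • (p : E)) 0
      rw [← inner_self_eq_zero (𝕜 := ℝ)]
      conv_lhs => rw [inner_sum]
      simpa [real_inner_smul_right] using this
    have := affineIndependent_iff.1 hs Finset.univ _ h0 h1
    ext u
    have := this u (Finset.mem_univ _)
    simpa using this

/-- A height function that is affine on no affinely dependent subset of `P`. -/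
theorem exists_generic_height (P : Finset E) :
    ∃ g : E → ℝ, ∀ s ⊆ P, (∃ (v : E) (k : ℝ), ∀ p ∈ s, inner ℝ v p + k = g p) →
      AffineIndependent ℝ ((↑) : s → E) := by
  classical
  let I := {s : Finset E // s ∈ P.powerset ∧ ¬ AffineIndependent ℝ ((↑) : s → E)}
  have hfin : Finite I := Finite.of_injective
    (fun i : I => (⟨i.1, i.2.1⟩ : {s // s ∈ P.powerset}))
    fun i j hij => Subtype.ext (by simpa using hij)
  have hex : ∀ i : I, ∃ w : E → ℝ, ∑ p ∈ i.1, w p = 0 ∧ ∑ p ∈ i.1, w p • p = 0 ∧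
      ∃ p ∈ i.1, w p ≠ 0 := by
    intro i
    have := i.2.2
    rw [affineIndependent_finset_iff] at this
    push Not at this
    exact this
  choose w hw0 hw1 hw2 using hex
  -- Each dependent subset gives one nonzero functional, and `g` only has to avoid finitely many
  -- kernels.
  let f : I → Module.Dual ℝ (E → ℝ) := fun i => ∑ p ∈ i.1, w i p • LinearMap.proj p
  have hf : ∀ i g, f i g = ∑ p ∈ i.1, w i p * g p := by
    intro i g
    simp [f]
  obtain ⟨g, hg⟩ := Module.Dual.exists_forall_ne_zero_of_forall_exists f (fun i => by
    obtain ⟨p, hp, hwp⟩ := hw2 i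
    refine ⟨Pi.single p 1, ?_⟩
    rw [hf, Finset.sum_eq_single p]
    · simpa using hwp
    · intro q _ hqp
      simp [hqp]
    · exact fun h => absurd hp h)
  refine ⟨g, fun s hs ⟨v, k, hvk⟩ => ?_⟩
  by_contra hdep
  apply hg ⟨s, Finset.mem_powerset.2 hs, hdep⟩
  rw [hf]
  set i : I := ⟨s, Finset.mem_powerset.2 hs, hdep⟩
  calc ∑ p ∈ s, w i p * g p = ∑ p ∈ s, (inner ℝ v (w i p • p) + k * w i p) := by
        refine Finset.sum_congr rfl fun p hp => ?_
        rw [← hvk p hp, real_inner_smul_right]; ring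
    _ = 0 := by
        rw [Finset.sum_add_distrib, ← inner_sum, ← Finset.mul_sum, hw0 i, hw1 i]; simp

/-- `s` is the set of contact points, among the points of `T`, of an affine function that lies
below the height function `h` on `T`. -/
def IsLowerCell (h : E → ℝ) (T s : Finset E) : Prop :=
  s ⊆ T ∧ ∃ (v : E) (k : ℝ), ∀ p ∈ T, inner ℝ v p + k ≤ h p ∧ (inner ℝ v p + k = h p ↔ p ∈ s)

theorem sum_mul_affine {P : Finset E} {a : E → ℝ} {x : E} (ha : ∑ p ∈ P, a p = 1)
    (hx : ∑ p ∈ P, a p • p = x) (v : E) (k : ℝ) :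
    ∑ p ∈ P, a p * (inner ℝ v p + k) = inner ℝ v x + k := by
  simp only [mul_add, Finset.sum_add_distrib, ← Finset.sum_mul, ha, one_mul, ← hx, inner_sum,
    real_inner_smul_right]

/-- Let `L` and `M` be the affine minorants of `s` and `t`. Averaging `h` with `a` gives `M x ≤ L
x`; averaging with `b` gives `L x ≤ M x`, with equality only if `L` touches `h` on the support of
`b`. The ground sets `A` and `B` may differ, so that cells of different cells can be compared. -/
theorem IsLowerCell.mem_of_ne_zero {h : E → ℝ} {P A B s t : Finset E} {a b : E → ℝ} {x : E}
    (hs : IsLowerCell h A s) (ht : IsLowerCell h B t)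
    (ha : ∀ p ∈ P, 0 ≤ a p) (ha1 : ∑ p ∈ P, a p = 1) (hax : ∑ p ∈ P, a p • p = x)
    (hb : ∀ p ∈ P, 0 ≤ b p) (hb1 : ∑ p ∈ P, b p = 1) (hbx : ∑ p ∈ P, b p • p = x)
    (has : ∀ p ∈ P, a p ≠ 0 → p ∈ s ∧ p ∈ B) (hbt : ∀ p ∈ P, b p ≠ 0 → p ∈ t ∧ p ∈ A) :
    ∀ p ∈ P, b p ≠ 0 → p ∈ s := by
  obtain ⟨hsA, v, k, hvk⟩ := hs
  obtain ⟨htB, u, l, hul⟩ := ht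
  have e1 : ∑ p ∈ P, a p * h p = inner ℝ v x + k := by
    rw [← sum_mul_affine ha1 hax]
    refine Finset.sum_congr rfl fun p hp => ?_
    by_cases h0 : a p = 0
    · simp [h0]
    · rw [((hvk p (hsA (has p hp h0).1)).2).2 (has p hp h0).1]
  have e2 : ∑ p ∈ P, b p * h p = inner ℝ u x + l := by
    rw [← sum_mul_affine hb1 hbx]
    refine Finset.sum_congr rfl fun p hp => ?_
    by_cases h0 : b p = 0
    · simp [h0]
    · rw [((hul p (htB (hbt p hp h0).1)).2).2 (hbt p hp h0).1]
  have i1 : inner ℝ u x + l ≤ ∑ p ∈ P, a p * h p := by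
    rw [← sum_mul_affine ha1 hax]
    refine Finset.sum_le_sum fun p hp => ?_
    by_cases h0 : a p = 0
    · simp [h0]
    · exact mul_le_mul_of_nonneg_left (hul p (has p hp h0).2).1 (ha p hp)
  have i2 : ∀ p ∈ P, b p * (inner ℝ v p + k) ≤ b p * h p := by
    intro p hp
    by_cases h0 : b p = 0
    · simp [h0]
    · exact mul_le_mul_of_nonneg_left (hvk p (hbt p hp h0).2).1 (hb p hp)
  have e3 : ∑ p ∈ P, b p * (inner ℝ v p + k) = ∑ p ∈ P, b p * h p := by
    refine le_antisymm (Finset.sum_le_sum i2) ?_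
    rw [sum_mul_affine hb1 hbx, e2, ← e1]; exact i1
  have e4 := (Finset.sum_eq_sum_iff_of_le i2).1 e3
  intro p hp h0
  exact ((hvk p (hbt p hp h0).2).2).1 (mul_left_cancel₀ h0 (e4 p hp))

/-- Tilt the minorant down by a small multiple of an affine function that is `0` on `t` and `1` on
the rest of `s`; points off `s` have slack to spare. -/
theorem IsLowerCell.of_subset {h : E → ℝ} {T s t : Finset E} (hs : IsLowerCell h T s)
    (hind : AffineIndependent ℝ ((↑) : s → E)) (hts : t ⊆ s) : IsLowerCell h T t := by
  classical
  obtain ⟨hsT, v, k, hvk⟩ := hs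
  obtain ⟨u, l, hul⟩ := hind.exists_affine_interpolation (fun p => if p ∈ t then 0 else 1)
  have hev : ∀ᶠ δ : ℝ in nhdsWithin 0 (Set.Ioi 0), ∀ p ∈ T, p ∉ s →
      inner ℝ v p + k - δ * (inner ℝ u p + l) < h p := by
    refine (Finset.eventually_all T).2 fun p hp => ?_
    by_cases hps : p ∈ s
    · simp [hps]
    · have hlt : inner ℝ v p + k < h p :=
        lt_of_le_of_ne (hvk p hp).1 fun he => hps ((hvk p hp).2.1 he)
      have hc : Continuous fun δ : ℝ => inner ℝ v p + k - δ * (inner ℝ u p + l) := by fun_prop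
      have := (hc.tendsto 0).eventually_lt_const (u := h p) (by simpa using hlt)
      filter_upwards [nhdsWithin_le_nhds this] with δ hδ _ using hδ
  obtain ⟨δ, hδ, hδ0⟩ := (hev.and self_mem_nhdsWithin).exists
  have hδ0 : 0 < δ := hδ0
  refine ⟨hts.trans hsT, v - δ • u, k - δ * l, fun p hp => ?_⟩
  have he : inner ℝ (v - δ • u) p + (k - δ * l) = inner ℝ v p + k - δ * (inner ℝ u p + l) := by
    rw [inner_sub_left, real_inner_smul_left]; ring
  rw [he]
  by_cases hps : p ∈ s
  · have e1 := (hvk p hp).2.2 hps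
    have e2 := hul p hps
    rw [e1, e2]
    by_cases hpt : p ∈ t
    · simp [hpt]
    · simp [hpt, hδ0.le, hδ0.ne']
  · have := hδ p hp hps
    exact ⟨this.le, fun h' => absurd h' this.ne, fun hpt => absurd (hts hpt) hps⟩

theorem AffineIndependent.isLowerCell_self {s : Finset E}
    (hs : AffineIndependent ℝ ((↑) : s → E)) (h : E → ℝ) : IsLowerCell h s s := by
  obtain ⟨v, k, hvk⟩ := hs.exists_affine_interpolation h
  exact ⟨subset_rfl, v, k, fun p hp => ⟨(hvk p hp).le, by simp [hp, hvk p hp]⟩⟩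

/-- A point in the interior of the convex hull of `P` lies in the convex hull of a lower cell. -/
theorem exists_isLowerCell_mem_convexHull [FiniteDimensional ℝ E] (h : E → ℝ) {P : Finset E}
    {x : E} (hx : x ∈ interior (convexHull ℝ (P : Set E))) :
    ∃ s, IsLowerCell h P s ∧ x ∈ convexHull ℝ (s : Set E) := by
  classical
  obtain ⟨M, hM⟩ : ∃ M, ∀ p ∈ P, h p ≤ M := by
    obtain ⟨M, hM⟩ := (P.image h).bddAbove
    exact ⟨M, fun p hp => hM (by simpa using ⟨p, hp, rfl⟩)⟩
  obtain ⟨m, hm⟩ : ∃ m, ∀ p ∈ P, m ≤ h p := by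
    obtain ⟨M, hM⟩ := (P.image h).bddBelow
    exact ⟨M, fun p hp => hM (by simpa using ⟨p, hp, rfl⟩)⟩
  obtain ⟨ρ, hρ, hball⟩ := Metric.nhds_basis_closedBall.mem_iff.1 (mem_interior_iff_mem_nhds.1 hx)
  -- affine functions are written `c + ⟪v, y - x⟫`, so that `c` is the value at `x`
  let S : Set (E × ℝ) := {z | (∀ p ∈ P, inner ℝ z.1 (p - x) + z.2 ≤ h p) ∧ m ≤ z.2}
  have hSc : IsClosed S := by
    have : S = (⋂ p ∈ P, {z : E × ℝ | inner ℝ z.1 (p - x) + z.2 ≤ h p}) ∩ {z | m ≤ z.2} := by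
      ext z; simp [S]
    rw [this]
    refine IsClosed.inter (isClosed_biInter fun p _ => ?_) ?_
    · exact isClosed_le (by fun_prop) continuous_const
    · exact isClosed_le continuous_const continuous_snd
  have hbound : ∀ z ∈ S, ∀ y ∈ convexHull ℝ (P : Set E), inner ℝ z.1 (y - x) + z.2 ≤ M := by
    intro z hz y hy
    have hconv : Convex ℝ {y : E | inner ℝ z.1 (y - x) + z.2 ≤ M} := by
      have : {y : E | inner ℝ z.1 (y - x) + z.2 ≤ M} =
          {y : E | innerSL ℝ z.1 y ≤ M - z.2 + inner ℝ z.1 x} := by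
        ext y; simp [inner_sub_right]; constructor <;> intro h <;> linarith
      rw [this]
      exact convex_halfSpace_le (innerSL ℝ z.1).isLinear _
    exact convexHull_min (fun p hp => (hz.1 p hp).trans (hM p hp)) hconv hy
  -- The gradient is bounded because a ball of radius `ρ` about `x` lies in the hull, where the
  -- minorant is at most `M`.
  have hSb : S ⊆ Metric.closedBall 0 (max ((M - m) / ρ) (max |m| |M|)) := by
    intro z hz
    have hz2 : z.2 ≤ M := by simpa using hbound z hz x (interior_subset hx)
    have hz1 : ‖z.1‖ ≤ (M - m) / ρ := by
      by_cases h0 : z.1 = 0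
      · rw [h0, norm_zero]; exact div_nonneg (by linarith [hz.2]) hρ.le
      have hn : 0 < ‖z.1‖ := norm_pos_iff.2 h0
      have := hbound z hz (x + (ρ / ‖z.1‖) • z.1) (hball (by
        simp [norm_smul, abs_of_pos hρ, hn.ne']))
      rw [add_sub_cancel_left, real_inner_smul_right, real_inner_self_eq_norm_sq] at this
      rw [le_div_iff₀ hρ]
      have e : ρ / ‖z.1‖ * ‖z.1‖ ^ 2 = ‖z.1‖ * ρ := by field_simp
      linarith [hz.2]
    rw [mem_closedBall_zero_iff, Prod.norm_def]
    refine max_le (hz1.trans (le_max_left _ _)) (le_trans ?_ (le_max_right _ _))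
    rw [Real.norm_eq_abs]
    exact abs_le_max_abs_abs hz.2 hz2
  have hScomp : IsCompact S := (isCompact_closedBall _ _).of_isClosed_subset hSc hSb
  have hSne : S.Nonempty := ⟨(0, m), fun p hp => by simpa using hm p hp, le_rfl⟩
  -- The minorant that is highest at `x`. Were `x` outside the hull of its contact points, a
  -- separating functional could tilt it to be higher still.
  obtain ⟨z, hzS, hzmax⟩ := hScomp.exists_isMaxOn hSne continuous_snd.continuousOn
  set s := P.filter fun p => inner ℝ z.1 (p - x) + z.2 = h p with hs
  refine ⟨s, ⟨Finset.filter_subset _ _, z.1, z.2 - inner ℝ z.1 x, fun p hp => ?_⟩, ?_⟩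
  · have e : inner ℝ z.1 p + (z.2 - inner ℝ z.1 x) = inner ℝ z.1 (p - x) + z.2 := by
      rw [inner_sub_right]; ring
    rw [e]
    exact ⟨hzS.1 p hp, by simp [hs, hp]⟩
  · by_contra hxs
    obtain ⟨f, u, hfu, hux⟩ := geometric_hahn_banach_closed_point (convex_convexHull ℝ (s : Set E))
      (s.finite_toSet.isClosed_convexHull (𝕜 := ℝ)) hxs
    let w : E := (InnerProductSpace.toDual ℝ E).symm f
    have hw : ∀ y, inner ℝ w y = f y := fun y => InnerProductSpace.toDual_symm_apply
    have hneg : ∀ p ∈ s, inner ℝ w (p - x) + (f x - u) < 0 := by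
      intro p hp
      have := hfu p (subset_convexHull ℝ _ hp)
      rw [hw, map_sub]; linarith
    have hev : ∀ᶠ δ : ℝ in nhdsWithin 0 (Set.Ioi 0), ∀ p ∈ P,
        inner ℝ (z.1 + δ • w) (p - x) + (z.2 + δ * (f x - u)) ≤ h p := by
      refine (Finset.eventually_all P).2 fun p hp => ?_
      have e : ∀ δ : ℝ, inner ℝ (z.1 + δ • w) (p - x) + (z.2 + δ * (f x - u)) =
          inner ℝ z.1 (p - x) + z.2 + δ * (inner ℝ w (p - x) + (f x - u)) := by
        intro δ; rw [inner_add_left, real_inner_smul_left]; ring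
      simp only [e]
      by_cases hps : p ∈ s
      · filter_upwards [self_mem_nhdsWithin] with δ hδ
        have h1 : inner ℝ z.1 (p - x) + z.2 = h p := (Finset.mem_filter.1 hps).2
        have := mul_neg_of_pos_of_neg (show (0 : ℝ) < δ from hδ) (hneg p hps)
        linarith
      · have hlt : inner ℝ z.1 (p - x) + z.2 < h p :=
          lt_of_le_of_ne (hzS.1 p hp) fun he => hps (Finset.mem_filter.2 ⟨hp, he⟩)
        have hc : Continuous fun δ : ℝ =>
          inner ℝ z.1 (p - x) + z.2 + δ * (inner ℝ w (p - x) + (f x - u)) := by fun_prop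
        have := (hc.tendsto 0).eventually_lt_const (u := h p) (by simpa using hlt)
        filter_upwards [nhdsWithin_le_nhds this] with δ hδ using hδ.le
    obtain ⟨δ, hδ, hδ0⟩ := (hev.and self_mem_nhdsWithin).exists
    have hδ0 : 0 < δ := hδ0
    have hpos : 0 < δ * (f x - u) := mul_pos hδ0 (by linarith)
    have hmem : (z.1 + δ • w, z.2 + δ * (f x - u)) ∈ S := ⟨hδ, by
      have := hzS.2
      show m ≤ z.2 + δ * (f x - u)
      linarith⟩
    have h3 := hzmax hmem
    have : z.2 + δ * (f x - u) ≤ z.2 := h3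
    linarith

end LowerCells

/-! ### The Delaunay complex of a finite point set. -/

section DelaunayComplex

variable {E : Type*} [NormedAddCommGroup E] [InnerProductSpace ℝ E]

/-- Padding with zeros writes representations over different cells as sums over one `P`. -/
theorem exists_weights_extend {s P : Finset E} (hsP : s ⊆ P) {x : E}
    (hx : x ∈ convexHull ℝ (s : Set E)) :
    ∃ a : E → ℝ, (∀ p ∈ P, 0 ≤ a p) ∧ ∑ p ∈ P, a p = 1 ∧ ∑ p ∈ P, a p • p = x ∧
      ∀ p ∈ P, a p ≠ 0 → p ∈ s := by
  classical
  obtain ⟨w, hw, hw1, hwx⟩ := Finset.mem_convexHull'.1 hx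
  have hinter : P ∩ s = s := Finset.inter_eq_right.2 hsP
  refine ⟨fun p => if p ∈ s then w p else 0, fun p _ => ?_, ?_, ?_, fun p _ hp => ?_⟩
  · dsimp only
    split_ifs with h
    exacts [hw p h, le_rfl]
  · rw [Finset.sum_ite_mem, hinter, hw1]
  · simp only [ite_smul, zero_smul]
    rw [Finset.sum_ite_mem, hinter, hwx]
  · by_contra h
    simp [h] at hp

theorem mem_convexHull_of_weights {P : Finset E} {S : Set E} {a : E → ℝ} {x : E}
    (ha : ∀ p ∈ P, 0 ≤ a p) (ha1 : ∑ p ∈ P, a p = 1) (hax : ∑ p ∈ P, a p • p = x)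
    (haS : ∀ p ∈ P, a p ≠ 0 → p ∈ S) : x ∈ convexHull ℝ S := by
  rw [← hax, ← Finset.sum_filter_of_ne (p := fun p => a p ≠ 0)
    (fun p _ hp h0 => hp (by rw [h0, zero_smul]))]
  refine (convex_convexHull ℝ S).sum_mem (fun p hp => ha p (Finset.mem_filter.1 hp).1) ?_
    fun p hp => subset_convexHull ℝ S (haS p (Finset.mem_filter.1 hp).1 (Finset.mem_filter.1 hp).2)
  rw [Finset.sum_filter_of_ne (fun p _ h => h), ha1]

/-- The supports of two representations of a common point are compared twice: through `h` they lie
in both `T` and `U`, after which `g` can be compared on them. -/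
theorem convexHull_inter_subset_of_isLowerCell [DecidableEq E] {h g : E → ℝ}
    {P T U s t : Finset E}
    (hT : IsLowerCell h P T) (hU : IsLowerCell h P U) (hs : IsLowerCell g T s)
    (ht : IsLowerCell g U t) :
    convexHull ℝ (s : Set E) ∩ convexHull ℝ (t : Set E) ⊆ convexHull ℝ (s ∩ t : Set E) := by
  rintro x ⟨hxs, hxt⟩
  obtain ⟨a, ha, ha1, hax, has⟩ := exists_weights_extend (hs.1.trans hT.1) hxs
  obtain ⟨b, hb, hb1, hbx, hbt⟩ := exists_weights_extend (ht.1.trans hU.1) hxt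
  have hbT := hT.mem_of_ne_zero hU ha ha1 hax hb hb1 hbx
    (fun p hp h0 => ⟨hs.1 (has p hp h0), hp⟩) (fun p hp h0 => ⟨ht.1 (hbt p hp h0), hp⟩)
  have haU := hU.mem_of_ne_zero hT hb hb1 hbx ha ha1 hax
    (fun p hp h0 => ⟨ht.1 (hbt p hp h0), hp⟩) (fun p hp h0 => ⟨hs.1 (has p hp h0), hp⟩)
  have hbs := hs.mem_of_ne_zero ht ha ha1 hax hb hb1 hbx
    (fun p hp h0 => ⟨has p hp h0, haU p hp h0⟩) (fun p hp h0 => ⟨hbt p hp h0, hbT p hp h0⟩)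
  exact mem_convexHull_of_weights hb hb1 hbx fun p hp h0 => ⟨hbs p hp h0, hbt p hp h0⟩

/-- The ball with diameter `pq` contains no point of `P` other than `p` and `q`. -/
def IsGabrielPair (P : Set E) (p q : E) : Prop :=
  p ∈ P ∧ q ∈ P ∧ ∀ y ∈ P, y ≠ p → y ≠ q → 0 < inner ℝ (y - p) (y - q)

/-- By Thales, `‖y‖ ^ 2` minus the affine function chosen here is `inner (y - p) (y - q)`. The case
`p = q` supplies the vertices. -/
theorem IsGabrielPair.isLowerCell [DecidableEq E] {P : Finset E} {p q : E}
    (h : IsGabrielPair (P : Set E) p q) :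
    IsLowerCell (fun y => ‖y‖ ^ 2) P {p, q} := by
  obtain ⟨hp, hq, hy⟩ := h
  refine ⟨by
    intro y hy
    rcases Finset.mem_insert.1 hy with rfl | hy
    · exact hp
    · rw [Finset.mem_singleton.1 hy]; exact hq, p + q, - inner ℝ p q, fun y hyP => ?_⟩
  have e : ‖y‖ ^ 2 = inner ℝ (p + q) y + - inner ℝ p q + inner ℝ (y - p) (y - q) := by
    rw [← real_inner_self_eq_norm_sq, inner_sub_left, inner_sub_right, inner_sub_right,
      inner_add_left, real_inner_comm y q]
    ring
  simp only [e]
  by_cases h1 : y = p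
  · simp [h1]
  by_cases h2 : y = q
  · simp [h2]
  have := hy y hyP h1 h2
  refine ⟨by linarith, ?_⟩
  simp [h1, h2, this.ne']

theorem affineIndependent_singleton_finset (p : E) :
    AffineIndependent ℝ ((↑) : ({p} : Finset E) → E) := by
  rw [affineIndependent_finset_iff]
  intro w h0 _
  simpa using h0

theorem affineIndependent_pair_finset [DecidableEq E] (p q : E) :
    AffineIndependent ℝ ((↑) : ({p, q} : Finset E) → E) := by
  by_cases hpq : p = q
  · subst hpq
    rw [Finset.pair_eq_singleton]
    exact affineIndependent_singleton_finset p
  rw [affineIndependent_finset_iff]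
  intro w h0 h1
  rw [Finset.sum_pair hpq] at h0 h1
  have e : w q = - w p := by linarith
  rw [e, neg_smul, ← sub_eq_add_neg, ← smul_sub, smul_eq_zero, sub_eq_zero] at h1
  have hp := h1.resolve_right hpq
  simp [e, hp]

/-- A Delaunay triangulation of a finite point set. -/
theorem exists_delaunay_complex [FiniteDimensional ℝ E] [DecidableEq E] (P : Finset E) :
    ∃ K : Geometry.SimplicialComplex ℝ E, (∀ s ∈ K.faces, s ⊆ P) ∧
      (∀ p q, IsGabrielPair (P : Set E) p q → {p, q} ∈ K.faces) ∧
      (∀ p ∈ P, {p} ∈ K.faces) ∧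
      (∀ s ∈ K.faces, ∃ (c : E) (r : ℝ), (∀ p ∈ s, dist p c = r) ∧ ∀ p ∈ P, r ≤ dist p c) ∧
      ∀ x ∈ convexHull ℝ (P : Set E), (∀ T ⊆ P, x ∉ frontier (convexHull ℝ (T : Set E))) →
        ∃ s ∈ K.faces, x ∈ interior (convexHull ℝ (s : Set E)) := by
  obtain ⟨g, hg⟩ := exists_generic_height P
  set h : E → ℝ := fun y => ‖y‖ ^ 2 with hh
  have hind : ∀ T s, IsLowerCell h P T → IsLowerCell g T s →
      AffineIndependent ℝ ((↑) : s → E) := by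
    intro T s hT ⟨hsT, v, k, hvk⟩
    exact hg s (hsT.trans hT.1) ⟨v, k, fun p hp => (hvk p (hsT hp)).2.2 hp⟩
  let K : Geometry.SimplicialComplex ℝ E :=
    -- `T` is a Delaunay cell, possibly with many cospherical vertices; `g` cuts it into simplices.
    { faces := {s | s.Nonempty ∧ ∃ T, IsLowerCell h P T ∧ IsLowerCell g T s}
      isRelLowerSet_faces := by
        rintro s ⟨hs, T, hT, hsT⟩
        exact ⟨hs, fun t hts ht => ⟨ht, T, hT, hsT.of_subset (hind T s hT hsT) hts⟩⟩
      indep := by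
        rintro s ⟨-, T, hT, hsT⟩
        exact hind T s hT hsT
      inter_subset_convexHull := by
        rintro s t ⟨-, T, hT, hsT⟩ ⟨-, U, hU, htU⟩
        exact convexHull_inter_subset_of_isLowerCell hT hU hsT htU }
  refine ⟨K, ?_, ?_, ?_, ?_, ?_⟩
  · rintro s ⟨-, T, hT, hsT⟩
    exact hsT.1.trans hT.1
  · intro p q hpq
    exact ⟨⟨p, by simp⟩, _, hpq.isLowerCell, (affineIndependent_pair_finset p q).isLowerCell_self g⟩
  · intro p hp
    refine ⟨⟨p, by simp⟩, {p}, ?_, (affineIndependent_singleton_finset p).isLowerCell_self g⟩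
    rw [← Finset.pair_eq_singleton]
    exact IsGabrielPair.isLowerCell ⟨hp, hp, fun y _ hy _ =>
      real_inner_self_pos.2 (sub_ne_zero.2 hy)⟩
  · rintro s ⟨⟨p, hp⟩, T, ⟨hTP, v, k, hvk⟩, hsT⟩
    -- Completing the square: contact points of the minorant are the points of `P` nearest to `v /
    -- 2`.
    let c : E := (1 / 2 : ℝ) • v
    have e : ∀ y : E, dist y c ^ 2 = ‖y‖ ^ 2 - (inner ℝ v y + k) + (‖c‖ ^ 2 + k) := by
      intro y
      rw [dist_eq_norm, norm_sub_sq_real, real_inner_smul_right, real_inner_comm]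
      ring
    refine ⟨c, dist p c, fun q hq => ?_, fun q hq => ?_⟩
    · rw [← sq_eq_sq₀ dist_nonneg dist_nonneg, e, e,
        (hvk p (hTP (hsT.1 hp))).2.2 (hsT.1 hp), (hvk q (hTP (hsT.1 hq))).2.2 (hsT.1 hq)]
      simp [hh]
    · rw [← sq_le_sq₀ dist_nonneg dist_nonneg, e, e, (hvk p (hTP (hsT.1 hp))).2.2 (hsT.1 hp)]
      have := (hvk q hq).1
      simp only [hh] at this ⊢
      linarith
  · intro x hx hfr
    -- Avoiding all frontiers keeps `x` interior to each cell found, so the covering lemma applies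
    -- twice.
    have hint : ∀ T ⊆ P, x ∈ convexHull ℝ (T : Set E) → x ∈ interior (convexHull ℝ (T : Set E)) :=
      fun T hT hxT => by
        by_contra hc
        exact hfr T hT ⟨subset_closure hxT, hc⟩
    obtain ⟨T, hT, hxT⟩ := exists_isLowerCell_mem_convexHull h (hint P subset_rfl hx)
    obtain ⟨s, hs, hxs⟩ := exists_isLowerCell_mem_convexHull g (hint T hT.1 hxT)
    refine ⟨s, ⟨?_, T, hT, hs⟩, hint s (hs.1.trans hT.1) hxs⟩
    by_contra hne
    rw [Finset.not_nonempty_iff_eq_empty] at hne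
    simp [hne] at hxs

/-- The convex hull of a proper subset of an affinely independent set misses the interior of the
simplex. -/
theorem AffineIndependent.convexHull_disjoint_interior {s t : Finset E}
    (hs : AffineIndependent ℝ ((↑) : s → E)) (hts : t ⊂ s) :
    Disjoint (convexHull ℝ (t : Set E)) (interior (convexHull ℝ (s : Set E))) := by
  classical
  rw [Set.disjoint_left]
  intro z hzt hzs
  obtain ⟨hts, hst⟩ := Finset.ssubset_iff_subset_ne.1 hts
  obtain ⟨q, hqs, hqt⟩ : ∃ q ∈ s, q ∉ t := by
    by_contra hc
    push Not at hc
    exact hst (hts.antisymm hc)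
  -- This function is nonnegative on the simplex and zero at `z`; an interior minimum makes it
  -- constant, yet it is `1` at `q`.
  obtain ⟨v, k, hvk⟩ := hs.exists_affine_interpolation (fun p => if p ∈ t then 0 else 1)
  have hnn : ∀ y ∈ convexHull ℝ (s : Set E), 0 ≤ inner ℝ v y + k := by
    have hconv : Convex ℝ {y : E | 0 ≤ inner ℝ v y + k} := by
      have : {y : E | 0 ≤ inner ℝ v y + k} = {y : E | -k ≤ innerSL ℝ v y} := by
        ext y; simp; constructor <;> intro h <;> linarith
      rw [this]
      exact convex_halfSpace_ge (innerSL ℝ v).isLinear _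
    intro y hy
    refine convexHull_min (fun p hp => ?_) hconv hy
    show 0 ≤ inner ℝ v p + k
    rw [hvk p hp]
    split_ifs <;> norm_num
  have hz0 : inner ℝ v z + k = 0 := by
    obtain ⟨w, hw, hw1, hwz⟩ := Finset.mem_convexHull'.1 hzt
    rw [← sum_mul_affine hw1 hwz]
    exact Finset.sum_eq_zero fun p hp => by rw [hvk p (hts hp), if_pos hp, mul_zero]
  have hc : Continuous fun δ : ℝ => z - δ • v := by fun_prop
  have hev : ∀ᶠ δ : ℝ in nhds 0, z - δ • v ∈ convexHull ℝ (s : Set E) :=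
    hc.continuousAt.preimage_mem_nhds (by simpa using mem_interior_iff_mem_nhds.1 hzs)
  obtain ⟨δ, hδ, hδ0⟩ := ((hev.filter_mono nhdsWithin_le_nhds).and
    (self_mem_nhdsWithin (a := (0 : ℝ)) (s := Set.Ioi 0))).exists
  have hδ0 : 0 < δ := hδ0
  have h1 := hnn _ hδ
  rw [inner_sub_right, real_inner_smul_right] at h1
  have hv : v = 0 := by
    by_contra hv
    have := mul_pos hδ0 (real_inner_self_pos.2 hv)
    linarith
  have h2 := hvk q hqs
  rw [if_neg hqt, hv, inner_zero_left] at h2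
  rw [hv, inner_zero_left] at hz0
  linarith

end DelaunayComplex

/-! ### Relative neighborhood edges. -/

section RNG

variable {X : Set Plane}

/-- A point seeing `pq` under an angle of at least 90° makes `pq` the strictly longest side of the
triangle, so it lies in the lens. -/
theorem IsRNGEdge.isGabrielPair {p q : Plane} (h : IsRNGEdge X p q) : IsGabrielPair X p q := by
  obtain ⟨hp, hq, -, hlens⟩ := h
  refine ⟨hp, hq, fun y hy hyp hyq => ?_⟩
  by_contra hc
  push Not at hc
  have e : dist p q ^ 2 = ‖y - q‖ ^ 2 - 2 * inner ℝ (y - p) (y - q) + ‖y - p‖ ^ 2 := by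
    rw [dist_eq_norm, show p - q = (y - q) - (y - p) by abel, norm_sub_sq_real, real_inner_comm]
  have h1 : 0 < ‖y - p‖ := norm_pos_iff.2 (sub_ne_zero.2 hyp)
  have h2 : 0 < ‖y - q‖ := norm_pos_iff.2 (sub_ne_zero.2 hyq)
  have : y ∈ lens X p q := by
    refine ⟨hy, ?_, ?_⟩
    · rw [dist_comm p y, dist_eq_norm y p]
      refine lt_of_pow_lt_pow_left₀ 2 dist_nonneg ?_
      nlinarith
    · rw [dist_comm q y, dist_eq_norm y q]
      refine lt_of_pow_lt_pow_left₀ 2 dist_nonneg ?_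
      nlinarith
  rw [hlens] at this
  exact this

/-- The edges of the relative neighborhood graph do not cross. -/
theorem IsRNGEdge.segment_inter_subset (hX : X.Finite) {p q p' q' : Plane} (h : IsRNGEdge X p q)
    (h' : IsRNGEdge X p' q') :
    segment ℝ p q ∩ segment ℝ p' q' ⊆ convexHull ℝ ({p, q} ∩ {p', q'}) := by
  classical
  -- Both edges are faces of one simplicial complex.
  obtain ⟨K, -, hK, -⟩ := exists_delaunay_complex hX.toFinset
  have := K.inter_subset_convexHull (hK p q (by simpa using h.isGabrielPair))
    (hK p' q' (by simpa using h'.isGabrielPair))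
  simpa using this

theorem isClosed_segment (p q : Plane) : IsClosed (segment ℝ p q) := by
  rw [← convexHull_pair]
  exact (Set.toFinite _).isClosed_convexHull (𝕜 := ℝ)

theorem isClosed_biUnion_segment (hX : X.Finite) {S : Set (Plane × Plane)}
    (hS : ∀ e ∈ S, IsRNGEdge X e.1 e.2) : IsClosed (⋃ e ∈ S, segment ℝ e.1 e.2) := by
  refine Set.Finite.isClosed_biUnion ((hX.prod hX).subset fun e he => ?_)
    fun e _ => isClosed_segment _ _
  exact ⟨(hS e he).1, (hS e he).2.1⟩

theorem isClosed_rngDrawing (hX : X.Finite) : IsClosed (rngDrawing X) := by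
  have : rngDrawing X = ⋃ e ∈ {e : Plane × Plane | IsRNGEdge X e.1 e.2}, segment ℝ e.1 e.2 := by
    ext z; simp [rngDrawing]
  rw [this]
  exact isClosed_biUnion_segment hX fun e he => he

end RNG

/-! ### Local structure of a face of the drawing near an edge. -/

section Polygon

variable {X F : Set Plane}

theorem IsRNGPolygon.isOpen (hX : X.Finite) (hF : IsRNGPolygon X F) : IsOpen F := by
  obtain ⟨⟨z, -, rfl⟩, -⟩ := hF
  exact (isClosed_rngDrawing hX).isOpen_compl.connectedComponentIn

theorem IsRNGPolygon.nonempty (hF : IsRNGPolygon X F) : F.Nonempty := by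
  obtain ⟨⟨z, hz, rfl⟩, -⟩ := hF
  exact ⟨z, mem_connectedComponentIn hz⟩

theorem IsRNGPolygon.notMem_rngDrawing (hF : IsRNGPolygon X F) {z : Plane} (hz : z ∈ F) :
    z ∉ rngDrawing X := by
  obtain ⟨⟨w, -, rfl⟩, -⟩ := hF
  exact connectedComponentIn_subset _ _ hz

theorem IsRNGPolygon.subset_of_isPreconnected (hF : IsRNGPolygon X F) {C : Set Plane}
    (hC : IsPreconnected C) (hCX : ∀ z ∈ C, z ∉ rngDrawing X) (hCF : (C ∩ F).Nonempty) :
    C ⊆ F := by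
  obtain ⟨⟨w, -, rfl⟩, -⟩ := hF
  obtain ⟨y, hyC, hyF⟩ := hCF
  rw [connectedComponentIn_eq hyF]
  exact hC.subset_connectedComponentIn hyC hCX

theorem IsRNGPolygon.mem_frontier_of_mem_closure (hX : X.Finite) (hF : IsRNGPolygon X F)
    {z : Plane} (hz : z ∈ closure F) (hzX : z ∈ rngDrawing X) : z ∈ frontier F := by
  rw [(hF.isOpen hX).frontier_eq]
  exact ⟨hz, fun h => hF.notMem_rngDrawing h hzX⟩

theorem IsRNGPolygon.frontier_subset (hX : X.Finite) (hF : IsRNGPolygon X F) :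
    frontier F ⊆ rngDrawing X := by
  intro z hz
  by_contra hzX
  rw [(hF.isOpen hX).frontier_eq] at hz
  obtain ⟨ε, hε, hball⟩ := Metric.isOpen_iff.1 (isClosed_rngDrawing hX).isOpen_compl z hzX
  have hsub := hF.subset_of_isPreconnected (convex_ball z ε).isPreconnected
    (fun w hw => hball hw) (by
      obtain ⟨y, hyF, hy⟩ := Metric.mem_closure_iff.1 hz.1 ε hε
      exact ⟨y, by rwa [Metric.mem_ball, dist_comm], hyF⟩)
  exact hz.2 (hsub (Metric.mem_ball_self hε))

/-- Near a point of the relative interior of an edge, the drawing coincides with the edge. -/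
theorem IsRNGEdge.exists_ball_inter (hX : X.Finite) {p q z : Plane} (h : IsRNGEdge X p q)
    (hz : z ∈ openSegment ℝ p q) :
    ∃ ε > 0, ∀ w ∈ Metric.ball z ε, w ∈ rngDrawing X → w ∈ segment ℝ p q := by
  let S : Set (Plane × Plane) := {e | IsRNGEdge X e.1 e.2 ∧ z ∉ segment ℝ e.1 e.2}
  have hzS : z ∈ (⋃ e ∈ S, segment ℝ e.1 e.2)ᶜ := by
    simp only [Set.mem_compl_iff, Set.mem_iUnion, not_exists]
    exact fun e he => he.2
  obtain ⟨ε, hε, hball⟩ := Metric.isOpen_iff.1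
    (isClosed_biUnion_segment hX (S := S) fun e he => he.1).isOpen_compl z hzS
  refine ⟨ε, hε, ?_⟩
  rintro w hw ⟨a, b, hab, hwab⟩
  by_cases hzab : z ∈ segment ℝ a b
  · have hzc := h.segment_inter_subset hX hab ⟨openSegment_subset_segment _ _ _ hz, hzab⟩
    have hpz : p ≠ z := by
      rintro rfl
      exact h.2.2.1 (left_mem_openSegment_iff.1 hz)
    have hqz : q ≠ z := by
      rintro rfl
      exact h.2.2.1 (right_mem_openSegment_iff.1 hz)
    have hp : p ∈ ({a, b} : Set Plane) := by
      by_contra hc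
      have := convexHull_mono (s := {p, q} ∩ {a, b}) (t := {q}) (by
        rintro y ⟨rfl | rfl, hy⟩
        · exact absurd hy hc
        · rfl) hzc
      rw [convexHull_singleton] at this
      exact hqz this.symm
    have hq : q ∈ ({a, b} : Set Plane) := by
      by_contra hc
      have := convexHull_mono (s := {p, q} ∩ {a, b}) (t := {p}) (by
        rintro y ⟨rfl | rfl, hy⟩
        · rfl
        · exact absurd hy hc) hzc
      rw [convexHull_singleton] at this
      exact hpz this.symm
    have hne := h.2.2.1
    rcases hp with rfl | hp <;> rcases hq with hq | hq
    · exact absurd hq.symm hne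
    · rw [Set.mem_singleton_iff.1 hq]; exact hwab
    · rw [Set.mem_singleton_iff.1 hp, hq, segment_symm]; exact hwab
    · exact absurd ((Set.mem_singleton_iff.1 hp).trans (Set.mem_singleton_iff.1 hq).symm) hne
  · exact absurd (Set.mem_biUnion (show (a, b) ∈ S from ⟨hab, hzab⟩) hwab) (hball hw)

/-- If the relative interior of an edge touches the polygon, then near that point the edge belongs
to the closed polygon. -/
theorem IsRNGPolygon.exists_ball_inter_openSegment (hX : X.Finite) (hF : IsRNGPolygon X F)
    {p q z : Plane} (h : IsRNGEdge X p q) (hz : z ∈ openSegment ℝ p q) (hzF : z ∈ closure F) :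
    ∃ ε > 0, ∀ w ∈ Metric.ball z ε, w ∈ openSegment ℝ p q → w ∈ closure F := by
  obtain ⟨ε, hε, hball⟩ := h.exists_ball_inter hX hz
  rw [openSegment_eq_image'] at hz
  obtain ⟨τ, ⟨hτ0, hτ1⟩, rfl⟩ := hz
  have hpq : 0 < ‖q - p‖ := norm_pos_iff.2 (sub_ne_zero.2 h.2.2.1.symm)
  set z := p + τ • (q - p) with hzdef
  set δ := min ε (min τ (1 - τ) * ‖q - p‖) with hδ
  have hδ0 : 0 < δ := lt_min hε (mul_pos (lt_min hτ0 (by linarith)) hpq)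
  refine ⟨δ, hδ0, fun w hw hws => ?_⟩
  -- points of the line through `p` and `q` near `z` lie on the edge
  have hline : ∀ σ : ℝ, p + σ • (q - p) ∈ Metric.ball z δ → p + σ • (q - p) ∈ rngDrawing X := by
    intro σ hσ
    refine ⟨p, q, h, ?_⟩
    rw [Metric.mem_ball, dist_eq_norm, hzdef, add_sub_add_left_eq_sub, ← sub_smul, norm_smul,
      Real.norm_eq_abs] at hσ
    have := lt_of_mul_lt_mul_right (hσ.trans_le (min_le_right _ _)) hpq.le
    have h1 := abs_lt.1 (this.trans_le (min_le_left _ _))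
    have h2 := abs_lt.1 (this.trans_le (min_le_right _ _))
    rw [segment_eq_image']
    exact ⟨σ, ⟨by linarith, by linarith⟩, rfl⟩
  rw [openSegment_eq_image'] at hws
  obtain ⟨ω, -, rfl⟩ := hws
  set w := p + ω • (q - p) with hwdef
  obtain ⟨y, hyF, hy⟩ := Metric.mem_closure_iff.1 hzF δ hδ0
  have hy : y ∈ Metric.ball z δ := by rwa [Metric.mem_ball, dist_comm]
  have hyX := hF.notMem_rngDrawing hyF
  -- Walk from `y` in `F` straight to `w`. Meeting the drawing before `w` would put `y` on the line
  -- `pq`, hence on the drawing.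
  let f : ℝ → Plane := fun t => y + t • (w - y)
  have hf : Continuous f := by fun_prop
  have hsub : f '' Set.Ico 0 1 ⊆ F := by
    refine hF.subset_of_isPreconnected (isPreconnected_Ico.image f hf.continuousOn) ?_
      ⟨y, ⟨0, by simp, by simp [f]⟩, hyF⟩
    rintro _ ⟨t, ⟨ht0, ht1⟩, rfl⟩ hft
    have hfb : f t ∈ Metric.ball z δ :=
      (convex_ball z δ).add_smul_sub_mem hy hw ⟨ht0, ht1.le⟩
    have hfs := hball _ (Metric.ball_subset_ball (min_le_left _ _) hfb) hft
    rw [segment_eq_image'] at hfs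
    obtain ⟨σ, -, hσ⟩ := hfs
    have ht : (1 - t) ≠ 0 := by linarith
    have hyl : y = p + ((1 - t)⁻¹ * (σ - t * ω)) • (q - p) := by
      have e : (1 - t) • y = (1 - t) • (p + ((1 - t)⁻¹ * (σ - t * ω)) • (q - p)) := by
        rw [smul_add, smul_smul, ← mul_assoc, mul_inv_cancel₀ ht, one_mul]
        have : (1 - t) • y = f t - t • w := by simp only [f]; module
        rw [this, ← hσ, hwdef]
        module
      exact smul_right_injective _ ht e
    apply hyX
    rw [hyl]
    apply hline
    rw [← hyl]
    exact hy
  show w ∈ closure F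
  rw [show w = f 1 by simp [f]]
  have h1 : (1 : ℝ) ∈ closure (Set.Ico (0 : ℝ) 1) := by
    rw [closure_Ico (by norm_num)]; simp
  exact closure_mono hsub (image_closure_subset_closure_image hf ⟨1, h1, rfl⟩)

/-- If the relative interior of an edge touches the polygon, then the edge is a side. -/
theorem IsRNGPolygon.segment_subset_frontier (hX : X.Finite) (hF : IsRNGPolygon X F)
    {p q z : Plane} (h : IsRNGEdge X p q) (hz : z ∈ openSegment ℝ p q) (hzF : z ∈ closure F) :
    segment ℝ p q ⊆ frontier F := by
  have hopen : openSegment ℝ p q ⊆ closure F := by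
    -- Connectedness of the open edge: its part in `closure F` is relatively open and closed.
    by_contra hc
    obtain ⟨y, hys, hyF⟩ := Set.not_subset.1 hc
    choose! ε hε hball using fun (w : Plane)
      (hw : w ∈ openSegment ℝ p q ∧ w ∈ closure F) =>
        hF.exists_ball_inter_openSegment hX h hw.1 hw.2
    let U : Set Plane := ⋃ w ∈ openSegment ℝ p q ∩ closure F, Metric.ball w (ε w)
    obtain ⟨w, hws, hwU, hwF⟩ := (convex_openSegment (𝕜 := ℝ) p q).isPreconnected U (closure F)ᶜ
      (isOpen_biUnion fun _ _ => Metric.isOpen_ball) isClosed_closure.isOpen_compl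
      (fun w hw => by
        by_cases hwF : w ∈ closure F
        · exact Or.inl (Set.mem_biUnion ⟨hw, hwF⟩ (Metric.mem_ball_self (hε w ⟨hw, hwF⟩)))
        · exact Or.inr hwF)
      ⟨z, hz, Set.mem_biUnion ⟨hz, hzF⟩ (Metric.mem_ball_self (hε z ⟨hz, hzF⟩))⟩ ⟨y, hys, hyF⟩
    obtain ⟨u, hu, hwu⟩ := Set.mem_iUnion₂.1 hwU
    exact hwF (hball u hu w hwu hws)
  intro w hw
  refine hF.mem_frontier_of_mem_closure hX ?_ ⟨p, q, h, hw⟩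
  exact closure_minimal hopen isClosed_closure (segment_subset_closure_openSegment hw)

end Polygon

/-! ### Sides of the polygon. -/

section Sides

variable {X F : Set Plane}

/-- Polar coordinates: the image of an interval times the unit sphere. -/
theorem isPreconnected_ball_diff_center {V : Type*} [NormedAddCommGroup V] [NormedSpace ℝ V]
    (h : 1 < Module.rank ℝ V) (z : V) (ε : ℝ) : IsPreconnected (Metric.ball z ε \ {z}) := by
  have hpre : IsPreconnected (Set.Ioo 0 ε ×ˢ Metric.sphere (0 : V) 1) :=
    isPreconnected_Ioo.prod (isPreconnected_sphere h 0 1)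
  have hf : Continuous fun x : ℝ × V => z + x.1 • x.2 := by fun_prop
  convert! hpre.image _ hf.continuousOn using 1
  ext w
  constructor
  · rintro ⟨hw, hwz⟩
    have hpos : 0 < ‖w - z‖ := norm_pos_iff.2 (sub_ne_zero.2 hwz)
    refine ⟨(‖w - z‖, ‖w - z‖⁻¹ • (w - z)), ⟨⟨hpos, by rwa [← dist_eq_norm]⟩, ?_⟩, ?_⟩
    · simp [norm_smul, hpos.ne']
    · simp [smul_smul, hpos.ne']
  · rintro ⟨⟨t, u⟩, ⟨⟨ht0, ht1⟩, hu⟩, rfl⟩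
    have hu1 : ‖u‖ = 1 := by simpa using hu
    refine ⟨by simpa [norm_smul, hu1, abs_of_pos ht0] using ht1, ?_⟩
    have hu0 : u ≠ 0 := by rintro rfl; simp at hu1
    simp [ht0.ne', hu0]

theorem one_lt_rank_plane : 1 < Module.rank ℝ Plane := by
  rw [← Module.finrank_eq_rank]
  simp

/-- The boundary of the polygon is a union of sides. -/
theorem IsRNGPolygon.exists_side (hX : X.Finite) (hF : IsRNGPolygon X F) {z : Plane}
    (hz : z ∈ frontier F) :
    ∃ p q, IsRNGEdge X p q ∧ z ∈ segment ℝ p q ∧ segment ℝ p q ⊆ frontier F := by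
  by_contra! hc
  have hopen : ∀ p q, IsRNGEdge X p q → z ∈ segment ℝ p q → ∀ w ∈ openSegment ℝ p q,
      w ∉ closure F := fun p q h hzpq w hw hwF =>
    hc p q h hzpq (hF.segment_subset_frontier hX h hw hwF)
  have hzF : z ∉ F := by
    rw [(hF.isOpen hX).frontier_eq] at hz
    exact hz.2
  have hzcl := frontier_subset_closure hz
  let S : Set (Plane × Plane) := {e | IsRNGEdge X e.1 e.2 ∧ z ∉ segment ℝ e.1 e.2}
  have hclosed : IsClosed ((⋃ e ∈ S, segment ℝ e.1 e.2) ∪ X \ {z}) :=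
    (isClosed_biUnion_segment hX fun e he => he.1).union (hX.subset Set.sdiff_subset).isClosed
  obtain ⟨ε, hε, hball⟩ := Metric.isOpen_iff.1 hclosed.isOpen_compl z (by
    simp only [Set.mem_compl_iff, Set.mem_union, Set.mem_iUnion, not_or, not_exists]
    exact ⟨fun e he => he.2, fun h => h.2 rfl⟩)
  -- Without a side at `z`, nothing stops `F` from filling a punctured ball; but `z` lies on an
  -- edge, whose relative interior enters that ball.
  have hsub : Metric.ball z ε \ {z} ⊆ F := by
    refine (isPreconnected_ball_diff_center one_lt_rank_plane z ε).subset_of_closure_inter_subset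
      (hF.isOpen hX) ?_ ?_
    · obtain ⟨y, hyF, hy⟩ := Metric.mem_closure_iff.1 hzcl ε hε
      refine ⟨y, ⟨by rwa [Metric.mem_ball, dist_comm], ?_⟩, hyF⟩
      rintro rfl
      exact hzF hyF
    · rintro w ⟨hwcl, hwb, hwz⟩
      by_contra hwF
      obtain ⟨p, q, hpq, hw⟩ := hF.frontier_subset hX (a := w) (by
        rw [(hF.isOpen hX).frontier_eq]; exact ⟨hwcl, hwF⟩)
      by_cases hzpq : z ∈ segment ℝ p q
      · rw [← insert_endpoints_openSegment] at hw
        rcases hw with rfl | rfl | hw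
        · exact hball hwb (Or.inr ⟨hpq.1, hwz⟩)
        · exact hball hwb (Or.inr ⟨hpq.2.1, hwz⟩)
        · exact hopen p q hpq hzpq w hw hwcl
      · exact hball hwb (Or.inl (Set.mem_biUnion (show (p, q) ∈ S from ⟨hpq, hzpq⟩) hw))
  obtain ⟨a, b, hab, hzab⟩ := hF.frontier_subset hX hz
  have hzo := hzab
  rw [← closure_openSegment] at hzo
  obtain ⟨w, hw, hwz⟩ := Metric.mem_closure_iff.1 hzo ε hε
  refine hopen a b hab hzab w hw (subset_closure (hsub ⟨by rwa [Metric.mem_ball, dist_comm], ?_⟩))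
  rintro rfl
  exact hopen a b hab hzab _ hw hzcl

theorem left_mem_polygonPoints {p q : Plane} (h : IsRNGEdge X p q)
    (hs : segment ℝ p q ⊆ frontier F) : p ∈ polygonPoints X F :=
  ⟨h.1, hs (left_mem_segment ℝ p q)⟩

theorem right_mem_polygonPoints {p q : Plane} (h : IsRNGEdge X p q)
    (hs : segment ℝ p q ⊆ frontier F) : q ∈ polygonPoints X F :=
  ⟨h.2.1, hs (right_mem_segment ℝ p q)⟩

theorem IsRNGPolygon.nonempty_sides (hX : X.Finite) (hF : IsRNGPolygon X F) :
    ∃ p q, IsRNGEdge X p q ∧ segment ℝ p q ⊆ frontier F := by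
  obtain ⟨z, hz⟩ := nonempty_frontier_iff.2 ⟨hF.nonempty, by
    rintro rfl
    exact NormedSpace.unbounded_univ ℝ Plane hF.2⟩
  obtain ⟨p, q, h, -, hs⟩ := hF.exists_side hX hz
  exact ⟨p, q, h, hs⟩

/-- A separating functional attains its maximum over `closure F` on a side, where it is bounded by
its values at the endpoints; an interior maximum would make it zero. -/
theorem IsRNGPolygon.subset_convexHull (hX : X.Finite) (hF : IsRNGPolygon X F) :
    F ⊆ convexHull ℝ (polygonPoints X F) := by
  intro x hx
  by_contra hxP
  have hfin : (polygonPoints X F).Finite := hX.subset Set.inter_subset_left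
  obtain ⟨f, u, hfu, hux⟩ := geometric_hahn_banach_closed_point
    (convex_convexHull ℝ (polygonPoints X F)) (hfin.isClosed_convexHull (𝕜 := ℝ)) hxP
  obtain ⟨y, hy, hmax⟩ := (hF.2.isCompact_closure).exists_isMaxOn ⟨x, subset_closure hx⟩
    f.continuous.continuousOn
  have hxy : f x ≤ f y := hmax (subset_closure hx)
  by_cases hyF : y ∈ F
  · have hloc : IsLocalMax f y :=
      Filter.mem_of_superset ((hF.isOpen hX).mem_nhds hyF) fun w hw => hmax (subset_closure hw)
    have hf0 : f = 0 := by
      rw [← hloc.fderiv_eq_zero, f.fderiv]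
    obtain ⟨p, q, h, hs⟩ := hF.nonempty_sides hX
    have := hfu p (_root_.subset_convexHull ℝ _ (left_mem_polygonPoints h hs))
    rw [hf0] at this hux
    simp only [zero_apply] at this hux
    linarith
  · obtain ⟨p, q, h, hyp, hs⟩ := hF.exists_side hX (z := y) (by
      rw [(hF.isOpen hX).frontier_eq]; exact ⟨hy, hyF⟩)
    have := hfu y (segment_subset_convexHull (left_mem_polygonPoints h hs)
      (right_mem_polygonPoints h hs) hyp)
    linarith

theorem IsRNGPolygon.exists_frontier_mem_segment (hX : X.Finite) (hF : IsRNGPolygon X F)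
    {m c : Plane} (hm : m ∈ closure F) (hc : c ∉ closure F) :
    ∃ z ∈ segment ℝ m c, z ∈ frontier F := by
  by_contra! hno
  have hsub : ∀ z ∈ segment ℝ m c, z ∈ closure F → z ∈ F := fun z hz hzF => by
    by_contra hzn
    apply hno z hz
    rw [(hF.isOpen hX).frontier_eq]
    exact ⟨hzF, hzn⟩
  have := (convex_segment (𝕜 := ℝ) m c).isPreconnected.subset_of_closure_inter_subset
    (hF.isOpen hX) ⟨m, left_mem_segment ℝ m c, hsub m (left_mem_segment ℝ m c) hm⟩
    fun z hz => hsub z hz.2 hz.1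
  exact hc (subset_closure (this (right_mem_segment ℝ m c)))

end Sides

/-! ### Delaunay triangulation of the polygon. -/

section UpperBound

variable {X F : Set Plane}

/-- Frontiers of convex sets are null. Covering these generic points suffices, since the underlying
space is closed. -/
theorem dense_notMem_frontier_convexHull (P : Finset Plane) :
    Dense {x : Plane | ∀ T ⊆ P, x ∉ frontier (convexHull ℝ (T : Set Plane))} := by
  apply MeasureTheory.Measure.dense_of_ae (μ := MeasureTheory.volume)
  have := (Finset.eventually_all 
    (l := MeasureTheory.ae (MeasureTheory.volume : MeasureTheory.Measure Plane)) P.powerset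
    (p := fun T x => x ∉ frontier (convexHull ℝ (T : Set Plane)))).2 fun T _ =>
      MeasureTheory.measure_eq_zero_iff_ae_notMem.1
        ((convex_convexHull ℝ (T : Set Plane)).addHaar_frontier MeasureTheory.volume)
  filter_upwards [this] with x hx T hT using hx T (Finset.mem_powerset.2 hT)

/-- The Delaunay triangulation of the polygon. -/
theorem IsRNGPolygon.exists_delaunay_triangulation (hX : X.Finite) (hF : IsRNGPolygon X F) :
    ∃ K, IsPolygonTriangulation X F K ∧ ∀ a b, IsComplexEdge K a b →
      IsDelaunayEdge (polygonPoints X F) a b ∧ segment ℝ a b ⊆ closure F := by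
  classical
  have hfin : (polygonPoints X F).Finite := hX.subset Set.inter_subset_left
  set P := hfin.toFinset with hP
  have hPc : (P : Set Plane) = polygonPoints X F := hfin.coe_toFinset
  have hPmem : ∀ p, p ∈ P ↔ p ∈ polygonPoints X F := fun p => hfin.mem_toFinset
  obtain ⟨K₀, hsub, hpair, hvert, hcirc, hcover⟩ := exists_delaunay_complex P
  have hside : ∀ p q, IsRNGEdge X p q → segment ℝ p q ⊆ frontier F → {p, q} ∈ K₀.faces := by
    intro p q h hs
    refine hpair p q ?_
    rw [hPc]
    exact ⟨left_mem_polygonPoints h hs, right_mem_polygonPoints h hs,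
      fun y hy => h.isGabrielPair.2.2 y hy.1⟩
  let K : Geometry.SimplicialComplex ℝ Plane :=
    { faces := {s | s ∈ K₀.faces ∧ convexHull ℝ (s : Set Plane) ⊆ closure F}
      isRelLowerSet_faces := fun s hs => ⟨K₀.nonempty_of_mem_faces hs.1, fun t hts ht =>
        ⟨K₀.down_closed hs.1 hts ht,
          (convexHull_mono (Finset.coe_subset.2 hts)).trans hs.2⟩⟩
      indep := fun hs => K₀.indep hs.1
      inter_subset_convexHull := fun hs ht => K₀.inter_subset_convexHull hs.1 ht.1 }
  have hKfaces : ∀ s, s ∈ K.faces ↔ s ∈ K₀.faces ∧ convexHull ℝ (s : Set Plane) ⊆ closure F :=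
    fun s => Iff.rfl
  have hinside : ∀ s ∈ K₀.faces, ∀ x ∈ F, x ∈ interior (convexHull ℝ (s : Set Plane)) →
      s ∈ K.faces := by
    intro s hs x hxF hxs
    -- Leaving `F` inside the simplex means crossing a side. That side is a face of `K₀`, so it
    -- meets the simplex in the hull of common vertices, a proper face missing the interior.
    have hint : interior (convexHull ℝ (s : Set Plane)) ⊆ F := by
      refine (convex_convexHull ℝ (s : Set Plane)).interior.isPreconnected
        |>.subset_of_closure_inter_subset (hF.isOpen hX) ⟨x, hxs, hxF⟩ ?_
      rintro z ⟨hzcl, hzs⟩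
      by_contra hzF
      obtain ⟨p, q, h, hz, hpq⟩ := hF.exists_side hX (z := z) (by
        rw [(hF.isOpen hX).frontier_eq]; exact ⟨hzcl, hzF⟩)
      have hz' := K₀.inter_subset_convexHull hs (hside p q h hpq) ⟨interior_subset hzs, by
        rw [Finset.coe_pair, convexHull_pair]; exact hz⟩
      by_cases hspq : s ⊆ {p, q}
      · have := convexHull_mono (𝕜 := ℝ) (Finset.coe_subset.2 hspq) (interior_subset hxs)
        rw [Finset.coe_pair, convexHull_pair] at this
        exact hF.notMem_rngDrawing hxF ⟨p, q, h, this⟩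
      · rw [← Finset.coe_inter] at hz'
        refine Set.disjoint_left.1 ((K₀.indep hs).convexHull_disjoint_interior
          (Finset.ssubset_iff_subset_ne.2 ⟨Finset.inter_subset_left, fun he => hspq ?_⟩)) hz' hzs
        exact Finset.inter_eq_left.1 he
    refine ⟨hs, ?_⟩
    refine subset_closure.trans ?_
    rw [← (convex_convexHull ℝ (s : Set Plane)).closure_interior_eq_closure_of_nonempty_interior
      ⟨x, hxs⟩]
    exact closure_mono hint
  refine ⟨K, ⟨fun v => ?_, ?_, ?_⟩, ?_⟩
  · rw [hKfaces, ← hPmem]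
    refine ⟨fun hv => hsub _ hv.1 (Finset.mem_singleton_self v), fun hv => ⟨hvert v hv, ?_⟩⟩
    rw [Finset.coe_singleton, convexHull_singleton, Set.singleton_subset_iff]
    exact frontier_subset_closure ((hPmem v).1 hv).2
  · refine subset_antisymm (Set.iUnion₂_subset fun s hs => hs.2) ?_
    have hKfin : K.faces.Finite :=
      P.powerset.finite_toSet.subset fun s hs => Finset.mem_coe.2 (Finset.mem_powerset.2 (hsub s hs.1))
    have hclosed : IsClosed K.space :=
      hKfin.isClosed_biUnion fun s _ => s.finite_toSet.isClosed_convexHull (𝕜 := ℝ)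
    have h1 := (dense_notMem_frontier_convexHull P).open_subset_closure_inter (hF.isOpen hX)
    refine (closure_minimal h1 isClosed_closure).trans (closure_minimal ?_ hclosed)
    rintro x ⟨hxF, hx⟩
    obtain ⟨s, hs, hxs⟩ := hcover x (by rw [hPc]; exact hF.subset_convexHull hX hxF) hx
    exact K.convexHull_subset_space (hinside s hs x hxF hxs) (interior_subset hxs)
  · intro a b h hs
    refine ⟨h.2.2.1, {a, b}, ⟨hside a b h hs, ?_⟩, by simp⟩
    rw [Finset.coe_pair, convexHull_pair]
    exact hs.trans frontier_subset_closure
  · rintro a b ⟨hne, s, hs, hsab⟩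
    have has : a ∈ s := by rw [← Finset.mem_coe, hsab]; simp
    have hbs : b ∈ s := by rw [← Finset.mem_coe, hsab]; simp
    obtain ⟨c, r, hr, hrP⟩ := hcirc s hs.1
    refine ⟨⟨(hPmem a).1 (hsub s hs.1 has), (hPmem b).1 (hsub s hs.1 hbs), hne, c, r, hr a has,
      hr b hbs, fun x hx => hrP x ((hPmem x).2 hx)⟩, ?_⟩
    have := hs.2
    rwa [hsab, convexHull_pair] at this

end UpperBound

/-! ### Long edges in every triangulation. -/

section LowerBound

variable {X F : Set Plane}

/-- A simplex of the plane containing a point at distance at least `r` from all vertices has an edge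
of length at least `√3 r`. -/
theorem exists_sqrt_three_mul_le_dist {s : Finset Plane} (hs : AffineIndependent ℝ ((↑) : s → Plane))
    {c : Plane} {r : ℝ} (hr : 0 < r) (hc : c ∈ convexHull ℝ (s : Set Plane))
    (hrs : ∀ p ∈ s, r ≤ dist p c) : ∃ u ∈ s, ∃ v ∈ s, u ≠ v ∧ Real.sqrt 3 * r ≤ dist u v := by
  classical
  have hcard : s.card ≤ 3 := by
    have h1 := hs.card_le_finrank_succ
    have h2 := Submodule.finrank_le (vectorSpan ℝ (Set.range ((↑) : s → Plane)))
    rw [finrank_euclideanSpace_fin] at h2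
    rw [Fintype.card_coe] at h1
    omega
  obtain ⟨w, hw, hw1, hwc⟩ := Finset.mem_convexHull'.1 hc
  -- With barycentric weights `w` of `c`, the mean of `|uv|²` over `v` is at least `2 r²`. Vertices
  -- other than `u` have total weight at most `2/3`, so one of them has `|uv|² ≥ 3 r²`.
  obtain ⟨u, hu, huw⟩ : ∃ u ∈ s, (1 / 3 : ℝ) ≤ w u := by
    refine Finset.exists_le_of_sum_le (Finset.nonempty_of_sum_ne_zero (by rw [hw1]; norm_num)) ?_
    rw [hw1, Finset.sum_const, nsmul_eq_mul]
    have : (s.card : ℝ) ≤ 3 := by exact_mod_cast hcard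
    linarith
  have hcross : ∑ v ∈ s, w v * inner ℝ (u - c) (v - c) = 0 := by
    have : ∑ v ∈ s, w v • (v - c) = 0 := by
      simp only [smul_sub, Finset.sum_sub_distrib, ← Finset.sum_smul, hwc, hw1, one_smul, sub_self]
    simp only [← real_inner_smul_right]
    rw [← inner_sum, this, inner_zero_right]
  have hsq : ∀ v, dist u v ^ 2 = dist u c ^ 2 + dist v c ^ 2 - 2 * inner ℝ (u - c) (v - c) := by
    intro v
    rw [dist_eq_norm, dist_eq_norm, dist_eq_norm, show u - v = (u - c) - (v - c) by abel,
      norm_sub_sq_real]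
    ring
  have hsum : 2 * r ^ 2 ≤ ∑ v ∈ s, w v * dist u v ^ 2 := by
    have e : ∑ v ∈ s, w v * dist u v ^ 2 = ∑ v ∈ s, w v * (dist u c ^ 2 + dist v c ^ 2) := by
      rw [← sub_eq_zero, ← Finset.sum_sub_distrib]
      calc _ = ∑ v ∈ s, -2 * (w v * inner ℝ (u - c) (v - c)) :=
            Finset.sum_congr rfl fun v _ => by rw [hsq]; ring
        _ = 0 := by rw [← Finset.mul_sum, hcross, mul_zero]
    rw [e]
    calc 2 * r ^ 2 = ∑ v ∈ s, w v * (2 * r ^ 2) := by rw [← Finset.sum_mul, hw1, one_mul]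
      _ ≤ _ := Finset.sum_le_sum fun v hv => mul_le_mul_of_nonneg_left (by
          have h1 := pow_le_pow_left₀ hr.le (hrs u hu) 2
          have h2 := pow_le_pow_left₀ hr.le (hrs v hv) 2
          linarith) (hw v hv)
  rw [← Finset.add_sum_erase s _ hu, dist_self] at hsum
  rw [← Finset.add_sum_erase s _ hu] at hw1
  by_contra! hlt
  have hlt' : ∀ v ∈ s.erase u, dist u v ^ 2 < 3 * r ^ 2 := by
    intro v hv
    have h1 := hlt u hu v (Finset.mem_of_mem_erase hv) (Finset.ne_of_mem_erase hv).symm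
    have h2 := pow_lt_pow_left₀ h1 dist_nonneg two_ne_zero
    rwa [mul_pow, Real.sq_sqrt (by norm_num)] at h2
  have hr2 : 0 < r ^ 2 := by positivity
  obtain ⟨v, hv, hv0⟩ : ∃ v ∈ s.erase u, w v * dist u v ^ 2 ≠ 0 := by
    apply Finset.exists_ne_zero_of_sum_ne_zero
    intro h0
    rw [h0] at hsum
    linarith
  have hwv : 0 < w v := lt_of_le_of_ne (hw v (Finset.mem_of_mem_erase hv)) fun h => hv0 (by
    rw [← h, zero_mul])
  have hlast : ∑ v ∈ s.erase u, w v * dist u v ^ 2 < ∑ v ∈ s.erase u, w v * (3 * r ^ 2) :=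
    Finset.sum_lt_sum (fun x hx => mul_le_mul_of_nonneg_left (hlt' x hx).le
      (hw x (Finset.mem_of_mem_erase hx))) ⟨v, hv, mul_lt_mul_of_pos_left (hlt' v hv) hwv⟩
  rw [← Finset.sum_mul] at hlast
  have : (∑ v ∈ s.erase u, w v) * (3 * r ^ 2) ≤ 2 / 3 * (3 * r ^ 2) :=
    mul_le_mul_of_nonneg_right (by linarith) (by positivity)
  linarith

/-- Stewart's theorem. -/
theorem dist_sq_of_mem_segment {E : Type*} [NormedAddCommGroup E] [InnerProductSpace ℝ E]
    {p q : E} (c : E) (τ : ℝ) :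
    dist (p + τ • (q - p)) c ^ 2 =
      (1 - τ) * dist p c ^ 2 + τ * dist q c ^ 2 - τ * (1 - τ) * dist p q ^ 2 := by
  have e1 : p + τ • (q - p) - c = (1 - τ) • (p - c) + τ • (q - c) := by module
  have e2 : p - q = (p - c) - (q - c) := by abel
  rw [dist_eq_norm, dist_eq_norm, dist_eq_norm, dist_eq_norm, e1, e2, norm_add_sq_real,
    norm_sub_sq_real (p - c) (q - c), norm_smul, norm_smul, mul_pow, mul_pow, Real.norm_eq_abs, Real.norm_eq_abs,
    sq_abs, sq_abs, real_inner_smul_left, real_inner_smul_right]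
  ring

theorem IsPolygonTriangulation.mem_polygonPoints {K : Geometry.SimplicialComplex ℝ Plane}
    (hK : IsPolygonTriangulation X F K) {s : Finset Plane} (hs : s ∈ K.faces) {p : Plane}
    (hp : p ∈ s) : p ∈ polygonPoints X F :=
  (hK.vertices_iff p).1 (K.down_closed hs (Finset.singleton_subset_iff.2 hp)
    (Finset.singleton_nonempty p))

/-- Every triangulation of the polygon has an edge that is at least `√3 / 2` times as long as a given
Delaunay edge inside the polygon. -/
theorem IsPolygonTriangulation.exists_long_edge (hX : X.Finite) (hF : IsRNGPolygon X F)
    {K : Geometry.SimplicialComplex ℝ Plane} (hK : IsPolygonTriangulation X F K) {a b : Plane}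
    (hab : IsDelaunayEdge (polygonPoints X F) a b) (hseg : segment ℝ a b ⊆ closure F) :
    ∃ u v, IsComplexEdge K u v ∧ Real.sqrt 3 / 2 * dist a b ≤ dist u v := by
  classical
  obtain ⟨-, -, hne, c, r, hac, hbc, hr⟩ := hab
  have hd : 0 < dist a b := dist_pos.2 hne
  have hd2 : dist a b ≤ 2 * r := by
    have := dist_triangle_right a b c
    linarith
  by_cases hc : c ∈ closure F
  · rw [← hK.space_eq, K.mem_space_iff] at hc
    obtain ⟨s, hs, hcs⟩ := hc
    obtain ⟨u, hu, v, hv, huv, hle⟩ := exists_sqrt_three_mul_le_dist (K.indep hs)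
      (by linarith : 0 < r) hcs fun p hp => hr p (hK.mem_polygonPoints hs hp)
    refine ⟨u, v, ⟨huv, {u, v}, K.down_closed hs ?_ ⟨u, by simp⟩, by simp⟩, ?_⟩
    · intro x hx
      rcases Finset.mem_insert.1 hx with rfl | hx
      · exact hu
      · rw [Finset.mem_singleton.1 hx]; exact hv
    · have := mul_le_mul_of_nonneg_left hd2 (Real.sqrt_nonneg 3)
      linarith
  · set m := a + (1 / 2 : ℝ) • (b - a) with hm
    have hmF : m ∈ closure F := hseg (by
      rw [segment_eq_image']; exact ⟨1 / 2, by norm_num, rfl⟩)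
    have hmc : dist m c ^ 2 = r ^ 2 - dist a b ^ 2 / 4 := by
      rw [hm, dist_sq_of_mem_segment, hac, hbc]; ring
    obtain ⟨z, hz, hzF⟩ := hF.exists_frontier_mem_segment hX hmF hc
    have hzc : dist z c ≤ dist m c := by
      rw [segment_eq_image'] at hz
      obtain ⟨t, ⟨ht0, ht1⟩, rfl⟩ := hz
      have e : m + t • (c - m) - c = (1 - t) • (m - c) := by module
      show dist (m + t • (c - m)) c ≤ _
      rw [dist_eq_norm, e, norm_smul, Real.norm_eq_abs, abs_of_nonneg (by linarith), dist_eq_norm]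
      exact mul_le_of_le_one_left (norm_nonneg _) (by linarith)
    obtain ⟨p, q, h, hzpq, hs⟩ := hF.exists_side hX hzF
    refine ⟨p, q, hK.sides p q h hs, ?_⟩
    have hpc := pow_le_pow_left₀ (by linarith) (hr p (left_mem_polygonPoints h hs)) 2
    have hqc := pow_le_pow_left₀ (by linarith) (hr q (right_mem_polygonPoints h hs)) 2
    rw [segment_eq_image'] at hzpq
    obtain ⟨τ, ⟨hτ0, hτ1⟩, rfl⟩ := hzpq
    have hz2 := pow_le_pow_left₀ dist_nonneg hzc 2
    have hpq : dist a b ≤ dist p q := by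
      -- As `p` and `q` are outside the circle, `r² - |pq|²/4 ≤ |zc|² ≤ |mc|² = r² - |ab|²/4`, using
      -- `τ (1 - τ) ≤ 1/4`.
      refine (sq_le_sq₀ hd.le dist_nonneg).1 ?_
      simp only [dist_sq_of_mem_segment] at hz2
      have h1 : (1 - τ) * r ^ 2 ≤ (1 - τ) * dist p c ^ 2 :=
        mul_le_mul_of_nonneg_left hpc (by linarith)
      have h2 : τ * r ^ 2 ≤ τ * dist q c ^ 2 := mul_le_mul_of_nonneg_left hqc hτ0
      have h3 : τ * (1 - τ) * dist p q ^ 2 ≤ 1 / 4 * dist p q ^ 2 :=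
        mul_le_mul_of_nonneg_right (by nlinarith [sq_nonneg (τ - 1 / 2)]) (sq_nonneg _)
      linarith
    have h3 : Real.sqrt 3 ≤ 2 := by
      rw [Real.sqrt_le_left (by norm_num)]; norm_num
    calc Real.sqrt 3 / 2 * dist a b ≤ 1 * dist a b :=
          mul_le_mul_of_nonneg_right (by linarith) hd.le
      _ ≤ dist p q := by rw [one_mul]; exact hpq

end LowerBound

/-! ### Existence of the two extremal lengths. -/

section Extrema

variable {X F : Set Plane}

theorem finite_dist_image (hX : X.Finite) :
    ((fun e : Plane × Plane => dist e.1 e.2) '' X ×ˢ X).Finite :=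
  (hX.prod hX).image _

theorem IsPolygonTriangulation.edgeLengths_subset {K : Geometry.SimplicialComplex ℝ Plane}
    (hK : IsPolygonTriangulation X F K) :
    edgeLengths K ⊆ (fun e : Plane × Plane => dist e.1 e.2) '' X ×ˢ X := by
  rintro _ ⟨a, b, ⟨-, s, hs, hsab⟩, rfl⟩
  have has : a ∈ s := by rw [← Finset.mem_coe, hsab]; simp
  have hbs : b ∈ s := by rw [← Finset.mem_coe, hsab]; simp
  exact ⟨(a, b), ⟨(hK.mem_polygonPoints hs has).1, (hK.mem_polygonPoints hs hbs).1⟩, rfl⟩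

theorem IsPolygonTriangulation.exists_isGreatest (hX : X.Finite) (hF : IsRNGPolygon X F)
    {K : Geometry.SimplicialComplex ℝ Plane} (hK : IsPolygonTriangulation X F K) :
    ∃ l, IsGreatest (edgeLengths K) l := by
  obtain ⟨p, q, h, hs⟩ := hF.nonempty_sides hX
  obtain ⟨l, hl, hmax⟩ := Set.exists_max_image (edgeLengths K) id
    ((finite_dist_image hX).subset hK.edgeLengths_subset) ⟨_, p, q, hK.sides p q h hs, rfl⟩
  exact ⟨l, hl, hmax⟩

theorem exists_isMinmaxLength (hX : X.Finite) (hF : IsRNGPolygon X F) :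
    ∃ δ, IsMinmaxLength X F δ := by
  obtain ⟨K, hK, -⟩ := hF.exists_delaunay_triangulation hX
  obtain ⟨l, hl⟩ := hK.exists_isGreatest hX hF
  obtain ⟨δ, hδ, hmin⟩ := Set.exists_min_image (longestEdgeLengths X F) id
    ((finite_dist_image hX).subset fun l ⟨K, hK, hl⟩ => hK.edgeLengths_subset hl.1) ⟨l, K, hK, hl⟩
  exact ⟨δ, hδ, hmin⟩

theorem exists_isLongestDelaunayLength (hX : X.Finite) (hF : IsRNGPolygon X F) :
    ∃ δ, IsLongestDelaunayLength X F δ := by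
  obtain ⟨K, hK, hKD⟩ := hF.exists_delaunay_triangulation hX
  obtain ⟨_, ⟨a, b, hab, rfl⟩, -⟩ := hK.exists_isGreatest hX hF
  obtain ⟨δ, hδ, hmax⟩ := Set.exists_max_image (delaunayLengthsInside X F) id
    ((finite_dist_image hX).subset fun l ⟨a, b, hab, _, hl⟩ =>
      ⟨(a, b), ⟨hab.1.1, hab.2.1.1⟩, hl.symm⟩)
    ⟨_, a, b, (hKD a b hab).1, (hKD a b hab).2, rfl⟩
  exact ⟨δ, hδ, hmax⟩

end Extrema

theorem lemma5 (X : Set Plane) (hX : X.Finite) (F : Set Plane) (hF : IsRNGPolygon X F) :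
    ∃ δMML δDR : ℝ, IsMinmaxLength X F δMML ∧ IsLongestDelaunayLength X F δDR ∧
      Real.sqrt 3 / 2 * δDR ≤ δMML ∧ δMML ≤ δDR := by
  obtain ⟨δMML, hMML⟩ := exists_isMinmaxLength hX hF
  obtain ⟨δDR, hDR⟩ := exists_isLongestDelaunayLength hX hF
  refine ⟨δMML, δDR, hMML, hDR, ?_, ?_⟩
  · obtain ⟨K, hK, hl⟩ := hMML.1
    obtain ⟨a, b, hab, hseg, rfl⟩ := hDR.1
    obtain ⟨u, v, huv, hle⟩ := hK.exists_long_edge hX hF hab hseg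
    exact hle.trans (hl.2 ⟨u, v, huv, rfl⟩)
  · obtain ⟨K, hK, hKD⟩ := hF.exists_delaunay_triangulation hX
    obtain ⟨l, hl⟩ := hK.exists_isGreatest hX hF
    refine (hMML.2 ⟨K, hK, hl⟩).trans ?_
    obtain ⟨a, b, hab, rfl⟩ := hl.1
    exact hDR.2 ⟨a, b, (hKD a b hab).1, (hKD a b hab).2, rfl⟩
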